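/- Let $L$ be a first-order language, $T$ an $L$-theory, and $|T| := |L|+\aleph_0$. Let $\Delta$ be an $L$-fragment closed under negations, i.e. a set of $L$-formulas containing $\top$ and $\bot$ and closed under $\wedge$, $\vee$ and $\neg$, and let $x$ be a finite tuple of variables. A formula $\varphi(x,y)$ has IP with respect to $T$ if in some model of $T$ there are tuples $(a_i)_{i<\omega}$, $(b_S)_{S\subseteq\omega}$ such that $\varphi(a_i,b_S)$ holds if and only if $i\in S$; $T$ is $\Delta$-NIP if no formula in $\Delta$ has IP with respect to $T$, for any partition of its variables. For a structure $N$, $S_x^{\Delta}(N)$ denotes the set of complete $\Delta$-types over $N$ in $x$, i.e. of the sets of formulas $\varphi(x,b)$ with $\varphi\in\Delta$ and $b$ in $N$ which are finitely satisfiable in $N$ and contain each such formula or its negation. A monster model is a structure $\mathcal U$ that is $\kappa$-saturated and strongly $\kappa$-homogeneous for some $\kappa>|T|$; a structure or cardinal is small (with respect to $\mathcal U$) if its cardinality is less than $\kappa$. If $\mathcal M\preceq\mathcal U$ and $p\in S_x^{\Delta}(M)$, a coheir of $p$ is a type $q\in S_x^{\Delta}(\mathcal U)$ which extends $p$ and is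 finitely satisfiable in $M$. 1. If $T$ is $\Delta$-NIP, then for all monster models $\mathcal U\models T$, all small models $\mathcal M\preceq\mathcal U$ and all $p\in S_x^{\Delta}(M)$, the number of coheirs of $p$ in $S_x^{\Delta}(\mathcal U)$ is at most $2^{|M|+|T|}$. 2. If some formula $\varphi(x,y)$ in $\Delta$ has IP with respect to $T$, then for every cardinal $\lambda\geq|T|$ there are a model $\mathcal M$ of $T$ of cardinality $\lambda$ and a type $p\in S_x^{\Delta}(M)$ which has exactly $2^{2^{\lambda}}$ coheirs in $S_x^{\Delta}(\mathcal U)$, for every monster model $\mathcal U\succeq\mathcal M$ with respect to which $\lambda$ is small. If moreover $T$ is complete, then $\mathcal M$ embeds elementarily in every monster model of $T$ with respect to which $\lambda$ is small. -/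

import Mathlib

open Cardinal FirstOrder

universe u v w

namespace Fragment

variable {L : FirstOrder.Language.{u, v}}

/-- `|T|`, the number of `L`-formulas: `|L| + ℵ₀`. It depends on the language only. -/
noncomputable def theoryCard (L : FirstOrder.Language.{u, v}) : Cardinal.{max u v} :=
  max ℵ₀ L.card

/-- An `L`-fragment: a set of `L`-formulas, in the variables `v₀, v₁, …` indexed by `ℕ`, which
contains `⊤` and `⊥` and is closed under conjunctions and disjunctions. -/
structure IsFragment (Δ : Set (L.Formula ℕ)) : Prop where
  top_mem : ⊤ ∈ Δ
  bot_mem : ⊥ ∈ Δ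
  inf_mem : ∀ φ ∈ Δ, ∀ ψ ∈ Δ, φ ⊓ ψ ∈ Δ
  sup_mem : ∀ φ ∈ Δ, ∀ ψ ∈ Δ, φ ⊔ ψ ∈ Δ

/-- The variables outside the finite tuple `x`. A formula `φ` together with `x` is read as the
partitioned formula `φ(x, y)`, where `y` stands for the variables outside `x`. (Only finitely many
of them occur in `φ`; the values given to the others are irrelevant.) -/
abbrev Outside (x : Finset ℕ) : Type := {n : ℕ // n ∉ x}

/-- The assignment giving the values `a` to the variables in `x`, and `b` to all the others. -/
def glue {N : Type w} {x : Finset ℕ} (a : x → N) (b : Outside x → N) (n : ℕ) : N :=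
  if h : n ∈ x then a ⟨n, h⟩ else b ⟨n, h⟩

/-- `φ(x, y)` has the independence property with respect to `T`: in some model of `T` there are
`(aᵢ : i < ω)` and `(b_S : S ⊆ ω)` such that `φ(aᵢ, b_S)` holds if and only if `i ∈ S`. -/
def HasIP (T : L.Theory) (φ : L.Formula ℕ) (x : Finset ℕ) : Prop :=
  ∃ (N : FirstOrder.Language.Theory.ModelType.{u, v, max u v} T) (a : ℕ → x → N) (b : Set ℕ → Outside x → N),
    ∀ (i : ℕ) (S : Set ℕ), φ.Realize (glue (a i) (b S)) ↔ i ∈ S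

/-- `T` is `Δ`-NIP: no formula in `Δ`, however its variables are partitioned, has the
independence property. -/
def IsDeltaNIP (T : L.Theory) (Δ : Set (L.Formula ℕ)) : Prop :=
  ∀ φ ∈ Δ, ∀ x : Finset ℕ, ¬ HasIP T φ x

/-- Formulas `φ(x, b)` over `N`, as pairs of a formula `φ(x, y)` and a tuple `b` from `N`. -/
abbrev ParamFormula (L : FirstOrder.Language.{u, v}) (x : Finset ℕ) (N : Type w) : Type (max u v w) :=
  L.Formula ℕ × (Outside x → N)

/-- The space `S_x^Δ(N)` of complete `Δ`-types over `N` in the variables `x`, for a set `Δ` that is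
closed under negations: the finitely satisfiable sets of formulas `φ(x, b)` with `φ ∈ Δ` and
`b` in `N` that contain each such formula or its negation. -/
@[ext]
structure DeltaType (Δ : Set (L.Formula ℕ)) (x : Finset ℕ) (N : Type w) [L.Structure N] where
  formulas : Set (ParamFormula L x N)
  mem_delta : ∀ ψ ∈ formulas, ψ.1 ∈ Δ
  finSat : ∀ s ⊆ formulas, s.Finite → ∃ a : x → N, ∀ ψ ∈ s, ψ.1.Realize (glue a ψ.2)
  complete : ∀ φ ∈ Δ, ∀ b : Outside x → N, (φ, b) ∈ formulas ∨ (φ.not, b) ∈ formulas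

/-- For an elementary extension `f : M ↪ₑ[L] U`, the type `q ∈ S_x^Δ(U)` is a coheir of
`p ∈ S_x^Δ(M)`: it extends `p` and is finitely satisfiable in `M`. -/
def IsCoheir {Δ : Set (L.Formula ℕ)} {x : Finset ℕ} {M U : Type w} [L.Structure M] [L.Structure U]
    (f : M ↪ₑ[L] U) (p : DeltaType Δ x M) (q : DeltaType Δ x U) : Prop :=
  (∀ ψ ∈ p.formulas, (ψ.1, f ∘ ψ.2) ∈ q.formulas) ∧
    ∀ s ⊆ q.formulas, s.Finite → ∃ a : x → M, ∀ ψ ∈ s, ψ.1.Realize (glue (f ∘ a) ψ.2)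

/-- `U` is `κ`-saturated: every finitely satisfiable set of formulas in finitely many variables
over a set of fewer than `κ` parameters is realized. -/
def IsSaturated (L : FirstOrder.Language.{u, v}) (κ : Cardinal.{w}) (U : Type w) [L.Structure U] : Prop :=
  ∀ A : Set U, #A < κ → ∀ (n : ℕ) (Γ : Set (L[[A]].Formula (Fin n))),
    (∀ s ⊆ Γ, s.Finite → ∃ c : Fin n → U, ∀ ψ ∈ s, ψ.Realize c) →
      ∃ c : Fin n → U, ∀ ψ ∈ Γ, ψ.Realize c

/-- `U` is strongly `κ`-homogeneous: every partial elementary map of `U` whose domain has fewer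
than `κ` elements extends to an automorphism of `U`. -/
def IsStronglyHomogeneous (L : FirstOrder.Language.{u, v}) (κ : Cardinal.{w}) (U : Type w)
    [L.Structure U] : Prop :=
  ∀ A : Set U, #A < κ → ∀ g : A → U,
    (∀ φ : L.Formula A, φ.Realize (fun a : A => (a : U)) ↔ φ.Realize g) →
      ∃ σ : U ≃[L] U, ∀ a : A, σ a = g a

/-- `U` is a monster model, with smallness bound `κ > |T|` (of its complete theory). -/
structure IsMonster (L : FirstOrder.Language.{u, v}) (κ : Cardinal.{w}) (U : Type w) [L.Structure U] :
    Prop where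
  card_lt : Cardinal.lift.{w} (theoryCard L) < Cardinal.lift.{max u v} κ
  saturated : IsSaturated L κ U
  homogeneous : IsStronglyHomogeneous L κ U

end Fragment

/-! Every coheir of `p` is the average type of the tuples of `M` along an ultrafilter on `x → M`, so
coheirs are counted through ultrafilters.

Under NIP, attach to an ultrafilter and a formula `φ` the sign patterns of `φ` realized along its
iterated powers (`iteratedPatterns`). Suppose two ultrafilters have the same patterns, but `φ(x, b)`
holds almost everywhere for only one of them. Along mixtures of the two, `b` realizes every sign
sequence; as the patterns agree, one ultrafilter can replace the mixture, and choosing points one at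
a time shatters any finite set. Hence the patterns determine the coheir, and they are subsets of a
set of size at most `|M| + |T|`.

With IP, compactness and Löwenheim–Skolem give `M` of size `λ` and `λ` many tuples whose finite
subsets are defined by instances of `φ` over `M`. In a saturated extension all subsets are, so
distinct ultrafilters on `λ` have distinct averages there. There are `2 ^ 2 ^ λ` ultrafilters
(`mk_ultrafilter`) but at most `2 ^ λ` types over `M`, so by König's theorem on cofinalities a
single `p` receives `2 ^ 2 ^ λ` coheirs. -/

namespace Fragment

/-! ### Counting ultrafilters -/

section Ultrafilters

variable {I : Type u}

open scoped Classical in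
/-- Hausdorff's independent family: sets `A ⊆ I` are coded by pairs `(F, S)` with `F ∩ A ∈ S`. -/
def hausdorffSet (A : Set I) : Set (Finset I × Finset (Finset I)) :=
  {z | z.1.filter (· ∈ A) ∈ z.2}

open scoped Classical in
theorem exists_finset_separating (s : Finset (Set I)) :
    ∃ F : Finset I, ∀ A ∈ s, ∀ B ∈ s, F.filter (· ∈ A) = F.filter (· ∈ B) → A = B := by
  have h : ∀ A B : Set I, ∃ t : Finset I, (∀ i ∈ t, (i ∈ A ↔ i ∈ B)) → A = B := by
    intro A B
    by_cases hAB : A = B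
    · exact ⟨∅, fun _ => hAB⟩
    · have : ∃ i, ¬ (i ∈ A ↔ i ∈ B) := by
        by_contra! hc
        exact hAB (Set.ext hc)
      obtain ⟨i, hi⟩ := this
      exact ⟨{i}, fun he => absurd (he i (Finset.mem_singleton_self i)) hi⟩
  choose t ht using h
  refine ⟨s.biUnion fun A => s.biUnion fun B => t A B, fun A hA B hB he =>
    ht A B fun i hi => ?_⟩
  have hmem : i ∈ s.biUnion fun A => s.biUnion fun B => t A B :=
    Finset.mem_biUnion.2 ⟨A, hA, Finset.mem_biUnion.2 ⟨B, hB, hi⟩⟩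
  have := Finset.ext_iff.1 he i
  simpa only [Finset.mem_filter, hmem, true_and] using this

theorem exists_ultrafilter_hausdorffSet (𝒜 : Set (Set I)) :
    ∃ u : Ultrafilter (Finset I × Finset (Finset I)), ∀ A, hausdorffSet A ∈ u ↔ A ∈ 𝒜 := by
  classical
  obtain ⟨u, hu⟩ := Ultrafilter.exists_ultrafilter_of_finite_inter_nonempty
    (Set.range fun A : Set I => if A ∈ 𝒜 then hausdorffSet A else (hausdorffSet A)ᶜ) (by
      intro T hT
      obtain ⟨s, rfl⟩ : ∃ s : Finset (Set I), s.image (fun A : Set I =>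
          if A ∈ 𝒜 then hausdorffSet A else (hausdorffSet A)ᶜ) = T := by
        rw [← Set.image_univ, Finset.subset_set_image_iff] at hT
        obtain ⟨s, -, hs⟩ := hT
        exact ⟨s, hs⟩
      obtain ⟨F, hF⟩ := exists_finset_separating s
      -- The second coordinate lists the traces on `F` of the members of `s` in `𝒜`; as `F`
      -- separates `s`, no other member of `s` has a listed trace.
      refine ⟨(F, (s.filter (· ∈ 𝒜)).image fun A => F.filter (· ∈ A)), ?_⟩
      simp only [Finset.coe_image, Set.sInter_image, Set.mem_iInter]
      intro A hA
      split_ifs with h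
      · exact Finset.mem_image.2 ⟨A, Finset.mem_filter.2 ⟨hA, h⟩, by congr⟩
      · intro hmem
        obtain ⟨B, hB, he⟩ := Finset.mem_image.1 hmem
        rw [Finset.mem_filter] at hB
        exact h (hF B hB.1 A hA (by convert he) ▸ hB.2))
  refine ⟨u, fun A => ?_⟩
  have hA : (if A ∈ 𝒜 then hausdorffSet A else (hausdorffSet A)ᶜ) ∈ u := hu ⟨A, rfl⟩
  split_ifs at hA with h
  · exact iff_of_true hA h
  · exact iff_of_false (Ultrafilter.compl_mem_iff_notMem.1 hA) h

theorem mk_ultrafilter_le (X : Type u) : #(Ultrafilter X) ≤ 2 ^ ((2 : Cardinal.{u}) ^ #X) := by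
  rw [← mk_set, ← mk_set]
  exact mk_le_of_injective (f := fun u : Ultrafilter X => {s : Set X | s ∈ u}) fun u u' h =>
    Ultrafilter.ext fun s => Set.ext_iff.1 h s

/-- Pospíšil's theorem. -/
theorem mk_ultrafilter (I : Type u) [Infinite I] :
    #(Ultrafilter I) = 2 ^ ((2 : Cardinal.{u}) ^ #I) := by
  refine (mk_ultrafilter_le I).antisymm ?_
  have hI : #(Finset I × Finset (Finset I)) = #I := by
    rw [mk_prod, lift_id, lift_id, mk_finset_of_infinite, mk_finset_of_infinite,
      mk_finset_of_infinite, mul_eq_self (aleph0_le_mk I)]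
  obtain ⟨e⟩ := Cardinal.eq.1 hI
  choose c hc using exists_ultrafilter_hausdorffSet (I := I)
  rw [← mk_set, ← mk_set]
  refine mk_le_of_injective (f := fun 𝒜 => (c 𝒜).map e) fun 𝒜 ℬ h => ?_
  ext A
  rw [← hc, ← hc, ← Set.preimage_image_eq (hausdorffSet A) e.injective, ← Ultrafilter.mem_map,
    ← Ultrafilter.mem_map]
  exact (Set.ext_iff.1 (congrArg (fun u : Ultrafilter I => {s | s ∈ u}) h)) _

end Ultrafilters

/-! ### Iterated ultrafilters and shattering -/

section Alternation

variable {X : Type u} {B : Type v} (A : B → X → Prop)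

/-- For each `(e, U)` in the list, from the head on, quantify "for `U`-almost all `x`"; then ask for
some `b` such that `A b x` has truth value `e` for all these pairs `(x, e)` and those in `l`. -/
def Iterated : List (Bool × Ultrafilter X) → List (X × Bool) → Prop
  | [], l => ∃ b, ∀ z ∈ l, (A b z.1 ↔ z.2 = true)
  | z :: us, l => ∀ᶠ x in (z.2 : Filter X), Iterated us ((x, z.1) :: l)

/-- The sign patterns realized along the iterated powers of `U`. -/
def iteratedPatterns (U : Ultrafilter X) : Set (List Bool × List (X × Bool)) :=
  {z | Iterated A (z.1.map fun e => (e, U)) z.2}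

variable {A}

/-- Mixtures reduce to one ultrafilter: by induction the inner quantifiers can all use the outermost
ultrafilter. This needs patterns that carry the list `l` of points already chosen. -/
theorem iterated_iff_of_iteratedPatterns_eq {U V : Ultrafilter X}
    (h : iteratedPatterns A U = iteratedPatterns A V) (us : List (Bool × Ultrafilter X))
    (hus : ∀ z ∈ us, z.2 = U ∨ z.2 = V) (l : List (X × Bool)) :
    Iterated A us l ↔ (us.map Prod.fst, l) ∈ iteratedPatterns A U := by
  induction us generalizing l with
  | nil => rfl
  | cons z us ih =>
    have hW : iteratedPatterns A z.2 = iteratedPatterns A U := by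
      rcases hus z List.mem_cons_self with hz | hz <;> rw [hz]
      exact h.symm
    rw [← hW]
    change (∀ᶠ x in (z.2 : Filter X), _) ↔ ∀ᶠ x in (z.2 : Filter X), _
    refine Filter.eventually_congr (Filter.Eventually.of_forall fun x => ?_)
    rw [ih (fun z' hz' => hus z' (List.mem_cons_of_mem _ hz')), ← hW]
    rfl

/-- The same `b` is the final witness for every `η`: quantify with `U` where the sign is true and
with `V` where it is false. -/
theorem iterated_of_separating {U V : Ultrafilter X} {b : B} (hU : ∀ᶠ x in (U : Filter X), A b x)
    (hV : ∀ᶠ x in (V : Filter X), ¬ A b x) (η : List Bool) (l : List (X × Bool))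
    (hl : ∀ z ∈ l, (A b z.1 ↔ z.2 = true)) :
    Iterated A (η.map fun e => (e, if e then U else V)) l := by
  induction η generalizing l with
  | nil => exact ⟨b, hl⟩
  | cons e η ih =>
    have key : ∀ᶠ x in ((if e then U else V : Ultrafilter X) : Filter X),
        (A b x ↔ e = true) := by
      cases e
      · simpa using hV
      · simpa using hU
    refine key.mono fun x hx => ih _ fun z hz => ?_
    rcases List.mem_cons.1 hz with rfl | hz
    · exact hx
    · exact hl z hz

/-- Finitely many large sets have a common point, so each `g i` can be chosen to suit all rows `j`
at once. -/
theorem exists_realizing_of_iterated {I J : Type*} [Finite J] (R : I → J → Bool)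
    (U : Ultrafilter X) (c : List I) (hc : c.Nodup) (l : J → List (X × Bool))
    (h : ∀ j, Iterated A (c.map fun i => (R i j, U)) (l j)) :
    ∃ g : I → X, ∀ j, ∃ b, (∀ z ∈ l j, (A b z.1 ↔ z.2 = true)) ∧
      ∀ i ∈ c, (A b (g i) ↔ R i j = true) := by
  classical
  induction c generalizing l with
  | nil =>
    have := Filter.nonempty_of_neBot (U : Filter X)
    refine ⟨fun _ => Classical.arbitrary X, fun j => ?_⟩
    obtain ⟨b, hb⟩ := h j
    exact ⟨b, hb, by simp⟩
  | cons i c ih =>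
    rw [List.nodup_cons] at hc
    have h' : ∀ j, ∀ᶠ x in (U : Filter X),
        Iterated A (c.map fun i => (R i j, U)) ((x, R i j) :: l j) := h
    obtain ⟨x, hx⟩ := (Filter.eventually_all.2 h').exists
    obtain ⟨g, hg⟩ := ih hc.2 _ hx
    refine ⟨Function.update g i x, fun j => ?_⟩
    obtain ⟨b, hb, hb'⟩ := hg j
    refine ⟨b, fun z hz => hb z (List.mem_cons_of_mem _ hz), fun k hk => ?_⟩
    rcases List.mem_cons.1 hk with rfl | hk
    · simpa using hb _ List.mem_cons_self
    · rw [Function.update_of_ne (fun he : k = i => hc.1 (he ▸ hk))]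
      exact hb' k hk

/-- If the iterated powers of two ultrafilters realize the same patterns, but the ultrafilters
disagree on some `A b`, then `A` shatters arbitrarily large finite sets. -/
theorem exists_shattered_of_iteratedPatterns_eq {U V : Ultrafilter X}
    (h : iteratedPatterns A U = iteratedPatterns A V) {b : B}
    (hU : ∀ᶠ x in (U : Filter X), A b x) (hV : ¬ ∀ᶠ x in (V : Filter X), A b x)
    {I : Type*} (F : Finset I) :
    ∃ (g : I → X) (c : Set I → B), ∀ i ∈ F, ∀ S : Set I, (A (c S) (g i) ↔ i ∈ S) := by
  classical
  rw [← Ultrafilter.eventually_not] at hV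
  have key : ∀ η : List Bool, Iterated A (η.map fun e => (e, U)) [] := by
    intro η
    have h1 := (iterated_iff_of_iteratedPatterns_eq h _ (by
      intro z hz
      obtain ⟨e, -, rfl⟩ := List.mem_map.1 hz
      cases e <;> simp) []).1 (iterated_of_separating hU hV η [] (by simp))
    simpa [iteratedPatterns, Function.comp_def] using h1
  obtain ⟨g, hg⟩ := exists_realizing_of_iterated (A := A) (J := Finset.powerset F)
    (fun i j => decide (i ∈ j.1)) U F.toList F.nodup_toList (fun _ => []) (fun j => by
      have := key (F.toList.map fun i => decide (i ∈ j.1))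
      rwa [List.map_map] at this)
  choose c hc using hg
  -- Only the trace of `S` on `F` matters, so finitely many rows suffice.
  refine ⟨g, fun S => c ⟨F.filter (· ∈ S), by simp⟩, fun i hi S => ?_⟩
  rw [(hc _).2 i (by simpa using hi)]
  simp [hi]

end Alternation

open FirstOrder.Language

/-! ### Compactness, saturation and universality -/

section ModelTheory

variable {L : FirstOrder.Language.{u, v}}

theorem comp_glue {N P : Type*} {x : Finset ℕ} (f : N → P) (a : x → N) (b : Outside x → N) :
    f ∘ glue a b = glue (f ∘ a) (f ∘ b) := by
  funext n
  simp only [Function.comp_apply, glue]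
  split_ifs <;> rfl

theorem realize_congr_freeVars {N α : Type*} [DecidableEq α] [L.Structure N] (φ : L.Formula α)
    {v v' : α → N} (h : ∀ a ∈ φ.freeVarFinset, v a = v' a) : φ.Realize v ↔ φ.Realize v' := by
  have h1 := BoundedFormula.realize_restrictFreeVar (φ := φ) (f := id)
    (v := fun a => v a) (xs := default) v (fun _ => rfl)
  have h2 := BoundedFormula.realize_restrictFreeVar (φ := φ) (f := id)
    (v := fun a => v a) (xs := default) v' (fun a => h a a.2)
  exact h1.symm.trans h2

/-- The theory saying that the constants `α` realize the formulas `Γ k` in a model of `T`. -/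
def realizingTheory (T : L.Theory) {α K : Type*} (Γ : K → L.Formula α) : L[[α]].Theory :=
  (L.lhomWithConstants α).onTheory T ∪ Set.range fun k => Formula.equivSentence (Γ k)

theorem isSatisfiable_realizingTheory {T : L.Theory} {α K : Type*} [Nonempty K]
    {Γ : K → L.Formula α}
    (h : ∀ F : Finset K, ∃ (N : Theory.ModelType.{u, v, w} T) (v : α → N),
      ∀ k ∈ F, (Γ k).Realize v) :
    (realizingTheory T Γ).IsSatisfiable := by
  -- `T` is put into every piece, which is why `K` must be nonempty.
  have he : realizingTheory T Γ =
      ⋃ k, ((L.lhomWithConstants α).onTheory T ∪ {Formula.equivSentence (Γ k)}) := by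
    rw [← Set.union_iUnion, Set.iUnion_singleton_eq_range]
    rfl
  rw [he, Theory.isSatisfiable_iUnion_iff_isSatisfiable_iUnion_finset]
  intro F
  obtain ⟨N, v, hv⟩ := h F
  let := constantsOn.structure v
  have hmod : N ⊨ ⋃ k ∈ F, ((L.lhomWithConstants α).onTheory T ∪
      {Formula.equivSentence (Γ k)}) := by
    refine (Theory.model_iff _).2 fun φ hφ => ?_
    simp only [Set.mem_iUnion] at hφ
    obtain ⟨k, hk, hφ | rfl⟩ := hφ
    · have hT : N ⊨ (L.lhomWithConstants α).onTheory T := (LHom.onTheory_model _ _).2 inferInstance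
      exact hT.realize_of_mem φ hφ
    · exact (Formula.realize_equivSentence N _).2 (hv k hk)
  exact Theory.Model.isSatisfiable N

theorem exists_realize_of_model_realizingTheory {T : L.Theory} {α K : Type*}
    {Γ : K → L.Formula α} (N : Type*) [L[[α]].Structure N] (hN : N ⊨ realizingTheory T Γ) :
    ∃ (_ : L.Structure N) (v : α → N), N ⊨ T ∧ ∀ k, (Γ k).Realize v := by
  let := (L.lhomWithConstants α).reduct N
  refine ⟨inferInstance, fun a => (L.con a : N), ?_, fun k => ?_⟩
  · exact (LHom.onTheory_model (L.lhomWithConstants α) T).1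
      (hN.mono Set.subset_union_left)
  · exact (Formula.realize_equivSentence N _).1
      (hN.realize_of_mem _ (Or.inr ⟨k, rfl⟩))

/-- Saturation, for indexed families of formulas with a family of parameters. -/
theorem IsSaturated.exists_realize {κ : Cardinal.{w}} {U : Type w} [L.Structure U]
    (hU : IsSaturated L κ U) {P : Type w} (c : P → U) (hP : #P < κ) {n : ℕ} {K : Type*}
    (Γ : K → L.Formula (P ⊕ Fin n))
    (h : ∀ F : Finset K, ∃ d : Fin n → U, ∀ k ∈ F, (Γ k).Realize (Sum.elim c d)) :
    ∃ d : Fin n → U, ∀ k, (Γ k).Realize (Sum.elim c d) := by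
  classical
  let Γ' : K → L[[Set.range c]].Formula (Fin n) := fun k =>
    BoundedFormula.constantsVarsEquiv.symm
      ((Γ k).relabel (Sum.map (Set.rangeFactorization c) id))
  have hΓ' : ∀ k (d : Fin n → U), (Γ' k).Realize d ↔ (Γ k).Realize (Sum.elim c d) := by
    intro k d
    have h1 : (Γ' k).Realize d ↔ _ := (BoundedFormula.realize_constantsVarsEquiv
      (φ := Γ' k) (v := d) (xs := default)).symm
    rw [h1, Equiv.apply_symm_apply]
    change Formula.Realize _ _ ↔ _
    rw [Formula.realize_relabel]
    refine iff_of_eq (congrArg _ ?_)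
    funext z
    rcases z with z | z
    · exact coe_con L (Set.range c)
    · rfl
  obtain ⟨d, hd⟩ := hU (Set.range c) (mk_range_le.trans_lt hP) n (Set.range Γ') (by
    intro s hs hfin
    lift s to Finset (L[[Set.range c]].Formula (Fin n)) using hfin
    obtain ⟨F, -, rfl⟩ := Finset.subset_set_image_iff.1 (hs.trans Set.image_univ.superset)
    obtain ⟨d, hd⟩ := h F
    refine ⟨d, fun ψ hψ => ?_⟩
    obtain ⟨k, hk, rfl⟩ := Finset.mem_image.1 hψ
    exact (hΓ' k d).2 (hd k hk))
  exact ⟨d, fun k => (hΓ' k d).1 (hd _ ⟨k, rfl⟩)⟩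

/-- A set of pairs is an elementary relation if related tuples satisfy the same formulas. -/
def IsElementaryRel (L : FirstOrder.Language.{u, v}) {M U : Type*} [L.Structure M] [L.Structure U]
    (G : Set (M × U)) : Prop :=
  ∀ (n : ℕ) (φ : L.Formula (Fin n)) (g : Fin n → M × U), (∀ i, g i ∈ G) →
    (φ.Realize (Prod.fst ∘ g) ↔ φ.Realize (Prod.snd ∘ g))

section ElementaryRel

variable {M U : Type w} [L.Structure M] [L.Structure U] {G : Set (M × U)}

theorem IsElementaryRel.realize_iff (hG : IsElementaryRel L G) {α : Type*} (φ : L.Formula α)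
    (g : α → M × U) (hg : ∀ a, g a ∈ G) :
    φ.Realize (Prod.fst ∘ g) ↔ φ.Realize (Prod.snd ∘ g) := by
  classical
  let e := Fintype.equivFin φ.freeVarFinset
  have key : ∀ (N : Type w) [L.Structure N] (v : α → N),
      Formula.Realize (φ.restrictFreeVar e : L.Formula (Fin _)) (fun i => v (e.symm i)) ↔
        φ.Realize v := fun N _ v =>
    BoundedFormula.realize_restrictFreeVar v fun a => by simp
  rw [← key M, ← key U]
  exact hG _ _ (fun i => g (e.symm i)) fun i => hg _

theorem IsElementaryRel.sUnion {c : Set (Set (M × U))} (hc : IsChain (· ⊆ ·) c)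
    (hne : c.Nonempty) (h : ∀ G ∈ c, IsElementaryRel L G) : IsElementaryRel L (⋃₀ c) := by
  intro n φ g hg
  obtain ⟨t, ht, hs⟩ := DirectedOn.exists_mem_subset_of_finite_of_subset_sUnion hne
    hc.directedOn (Set.finite_range g) (Set.range_subset_iff.2 hg)
  exact h t ht n φ g fun i => hs ⟨i, rfl⟩

theorem isElementaryRel_empty (h : ∀ φ : L.Sentence, M ⊨ φ ↔ U ⊨ φ) :
    IsElementaryRel L (∅ : Set (M × U)) := by
  intro n φ g hg
  have hn : IsEmpty (Fin n) := ⟨fun i => hg i⟩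
  have key : ∀ (N : Type w) [L.Structure N] (v : Fin n → N),
      N ⊨ (φ.relabel isEmptyElim : L.Sentence) ↔ φ.Realize v := by
    intro N _ v
    unfold Sentence.Realize
    rw [Formula.realize_relabel]
    exact iff_of_eq (congrArg _ (Subsingleton.elim _ _))
  rw [← key M, ← key U]
  exact h _

/-- Equality is a formula, so elementary relations are automatically partial maps. -/
theorem IsElementaryRel.eq_of_mem (hG : IsElementaryRel L G) {m : M} {y z : U} (hy : (m, y) ∈ G)
    (hz : (m, z) ∈ G) : y = z := by
  have := hG 2 (Term.equal (Term.var 0) (Term.var 1)) ![(m, y), (m, z)] (by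
    intro i
    fin_cases i
    · exact hy
    · exact hz)
  simpa [Formula.realize_equal] using this

theorem IsElementaryRel.mk_le (hG : IsElementaryRel L G) : #G ≤ #M :=
  mk_le_of_injective (f := fun z : G => z.1.1) fun y z h =>
    Subtype.ext (Prod.ext h (hG.eq_of_mem y.2 (by
      have h : y.1.1 = z.1.1 := h
      rw [h]; exact z.2)))

/-- The type of `m` over the domain of `G`, carried over to `U`, is finitely satisfiable because `G`
preserves existential quantifications of finite conjunctions; saturation realizes it. -/
theorem IsElementaryRel.exists_insert {κ : Cardinal.{w}} (hU : IsSaturated L κ U) (hM : #M < κ)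
    (hG : IsElementaryRel L G) (m : M) : ∃ d : U, IsElementaryRel L (insert (m, d) G) := by
  classical
  obtain ⟨d, hd⟩ := hU.exists_realize (fun z : G => z.1.2) (hG.mk_le.trans_lt hM) (n := 1)
    (K := {ψ : L.Formula (G ⊕ Fin 1) //
      ψ.Realize (Sum.elim (fun z : G => z.1.1) fun _ => m)})
    (fun ψ => ψ.1) (by
      intro F
      let χ : L.Formula (G ⊕ Fin 1) := Formula.iInf fun ψ : F => ψ.1.1
      have h1 : (χ.iExs (Fin 1)).Realize (Prod.fst ∘ fun z : G => z.1) :=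
        Formula.realize_iExs.2 ⟨fun _ => m, Formula.realize_iInf.2 fun ψ => ψ.1.2⟩
      rw [hG.realize_iff _ _ fun z => z.2] at h1
      obtain ⟨d, hd⟩ := Formula.realize_iExs.1 h1
      exact ⟨d, fun k hk => Formula.realize_iInf.1 hd ⟨k, hk⟩⟩)
  have key : ∀ ψ : L.Formula (G ⊕ Fin 1),
      ψ.Realize (Sum.elim (fun z : G => z.1.1) fun _ => m) →
      ψ.Realize (Sum.elim (fun z : G => z.1.2) d) := fun ψ h => hd ⟨ψ, h⟩
  refine ⟨d 0, fun n φ g hg => ?_⟩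
  let r : Fin n → G ⊕ Fin 1 := fun i => if h : g i ∈ G then Sum.inl ⟨g i, h⟩ else Sum.inr 0
  have hM' : Sum.elim (fun z : G => z.1.1) (fun _ => m) ∘ r = Prod.fst ∘ g := by
    funext i
    by_cases h : g i ∈ G
    · simp [r, h]
    · simp [r, h, congrArg Prod.fst ((hg i).resolve_right h)]
  have hU' : Sum.elim (fun z : G => z.1.2) d ∘ r = Prod.snd ∘ g := by
    funext i
    by_cases h : g i ∈ G
    · simp [r, h]
    · simp [r, h, congrArg Prod.snd ((hg i).resolve_right h)]
  have key' : ∀ ψ : L.Formula (Fin n), ψ.Realize (Prod.fst ∘ g) → ψ.Realize (Prod.snd ∘ g) := by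
    intro ψ h
    rw [← hU', ← Formula.realize_relabel]
    rw [← hM', ← Formula.realize_relabel] at h
    exact key _ h
  refine ⟨key' φ, fun h => ?_⟩
  by_contra hn
  exact Formula.realize_not.1 (key' φ.not (Formula.realize_not.2 hn)) h

/-- Saturated structures are universal. -/
theorem IsSaturated.nonempty_elementaryEmbedding {κ : Cardinal.{w}} (hU : IsSaturated L κ U)
    (hM : #M < κ) (h : ∀ φ : L.Sentence, M ⊨ φ ↔ U ⊨ φ) : Nonempty (M ↪ₑ[L] U) := by
  obtain ⟨G, -, hG⟩ := zorn_subset_nonempty {G : Set (M × U) | IsElementaryRel L G}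
    (fun c hc hchain hne => ⟨⋃₀ c, IsElementaryRel.sUnion hchain hne hc,
      fun s hs => Set.subset_sUnion_of_mem hs⟩) ∅ (isElementaryRel_empty h)
  have hdom : ∀ m, ∃ d, (m, d) ∈ G := by
    intro m
    obtain ⟨d, hd⟩ := IsElementaryRel.exists_insert hU hM hG.prop m
    exact ⟨d, hG.le_of_ge hd (Set.subset_insert _ _) (Set.mem_insert _ _)⟩
  choose f hf using hdom
  exact ⟨⟨f, fun n φ y => (hG.prop n φ (fun i => (y i, f (y i))) fun i => hf _).symm⟩⟩

end ElementaryRel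

end ModelTheory

/-! ### Types, coheirs and average types -/

section Types

variable {L : FirstOrder.Language.{u, v}} {Δ : Set (L.Formula ℕ)} {x : Finset ℕ}

section DeltaTypes

variable {N : Type w} [L.Structure N]

theorem DeltaType.eq_of_subset {q r : DeltaType Δ x N} (h : q.formulas ⊆ r.formulas) : q = r := by
  refine DeltaType.ext (h.antisymm fun ψ hψ => ?_)
  refine (q.complete ψ.1 (r.mem_delta ψ hψ) ψ.2).resolve_right fun hn => ?_
  obtain ⟨a, ha⟩ := r.finSat {ψ, (ψ.1.not, ψ.2)} (Set.pair_subset hψ (h hn)) (Set.toFinite _)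
  exact Formula.realize_not.1 (ha _ (Or.inr rfl)) (ha _ (Or.inl rfl))

theorem DeltaType.mem_of_agree (q : DeltaType Δ x N) {φ : L.Formula ℕ} {b c : Outside x → N}
    (hbc : ∀ k : Outside x, k.1 ∈ φ.freeVarFinset → b k = c k) (h : (φ, b) ∈ q.formulas) :
    (φ, c) ∈ q.formulas := by
  refine (q.complete φ (q.mem_delta _ h) c).resolve_right fun hn => ?_
  obtain ⟨a, ha⟩ := q.finSat {(φ, b), (φ.not, c)} (Set.pair_subset h hn) (Set.toFinite _)
  refine Formula.realize_not.1 (ha _ (Or.inr rfl)) ?_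
  refine (realize_congr_freeVars φ fun k hk => ?_).1 (ha _ (Or.inl rfl))
  simp only [glue]
  split_ifs with hx
  · rfl
  · exact hbc ⟨k, hx⟩ hk

/-- The average type of a family of tuples along an ultrafilter. -/
def averageType (hneg : ∀ φ ∈ Δ, φ.not ∈ Δ) {I : Type*} (g : I → x → N) (V : Ultrafilter I) :
    DeltaType Δ x N where
  formulas := {ψ | ψ.1 ∈ Δ ∧ ∀ᶠ i in (V : Filter I), ψ.1.Realize (glue (g i) ψ.2)}
  mem_delta ψ hψ := hψ.1
  finSat s hs hfin := by
    obtain ⟨i, hi⟩ := ((Filter.eventually_all_finite hfin).2 fun ψ hψ => (hs hψ).2).exists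
    exact ⟨g i, hi⟩
  complete φ hφ b := by
    by_cases h : ∀ᶠ i in (V : Filter I), φ.Realize (glue (g i) b)
    · exact Or.inl ⟨hφ, h⟩
    · refine Or.inr ⟨hneg φ hφ, ?_⟩
      simpa only [Formula.realize_not] using Ultrafilter.eventually_not.2 h

theorem mk_formula_le : #(L.Formula ℕ) ≤ theoryCard L := by
  refine (mk_le_of_injective (f := fun φ : L.Formula ℕ =>
    (⟨0, φ⟩ : Σ n, L.BoundedFormula ℕ n)) fun φ ψ h => by simpa using h).trans ?_
  refine BoundedFormula.card_le.trans ?_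
  rw [mk_nat, lift_aleph0, lift_uzero, add_eq_max le_rfl, ← max_assoc, max_self]
  exact le_rfl

theorem mk_tuples_le (N : Type w) (x : Finset ℕ) : #(x → N) ≤ max ℵ₀ #N := by
  rw [mk_arrow, mk_coe_finset, lift_natCast, lift_uzero]
  exact (power_le_power_right (le_max_right ℵ₀ #N)).trans (power_nat_le (le_max_left _ _))

theorem mk_deltaType_le (N : Type w) [L.Structure N] [Infinite N]
    (hN : Cardinal.lift.{w} (theoryCard L) ≤ Cardinal.lift.{max u v} #N) :
    #(DeltaType Δ x N) ≤ 2 ^ Cardinal.lift.{max u v} #N := by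
  -- Parameter tuples are infinite, but only the variables of `φ` matter; coding them by lists
  -- avoids a factor `#N ^ ℵ₀`.
  let d : List N → Outside x → N := fun l k => l.getD k.1 (Classical.arbitrary N)
  have hinj : Function.Injective fun q : DeltaType Δ x N =>
      {z : L.Formula ℕ × List N | (z.1, d z.2) ∈ q.formulas} := by
    intro q r h
    refine DeltaType.eq_of_subset fun ⟨φ, b⟩ hψ => ?_
    let b' : ℕ → N := glue (fun _ => Classical.arbitrary N) b
    let l := (List.range (φ.freeVarFinset.sup id + 1)).map b'
    have hl : ∀ k : Outside x, k.1 ∈ φ.freeVarFinset → b k = d l k := by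
      intro k hk
      have hlt : k.1 < φ.freeVarFinset.sup id + 1 :=
        Nat.lt_succ_of_le (Finset.le_sup (f := id) hk)
      simp [d, l, b', glue, List.getD, hlt, k.2]
    have h1 : (φ, d l) ∈ q.formulas := q.mem_of_agree hl hψ
    have h2 : (φ, d l) ∈ r.formulas := (Set.ext_iff.1 h (φ, l)).1 h1
    exact r.mem_of_agree (fun k hk => (hl k hk).symm) h2
  refine (mk_le_of_injective hinj).trans ?_
  rw [mk_set]
  refine power_le_power_left two_ne_zero ?_
  rw [mk_prod, mk_list_eq_mk]
  refine (mul_le_mul' ((lift_le.2 mk_formula_le).trans hN) le_rfl).trans ?_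
  exact (mul_eq_self (by simp)).le

end DeltaTypes

section Coheirs

variable {M U : Type w} [L.Structure M] [L.Structure U] {f : M ↪ₑ[L] U} {p : DeltaType Δ x M}

/-- Finite satisfiability in `M` says that the solution sets in `M` of the formulas of `q` have the
finite intersection property. -/
theorem IsCoheir.exists_eq_averageType (hneg : ∀ φ ∈ Δ, φ.not ∈ Δ) {q : DeltaType Δ x U}
    (hq : IsCoheir f p q) :
    ∃ V : Ultrafilter (x → M), q = averageType hneg (fun a => f ∘ a) V := by
  classical
  obtain ⟨V, hV⟩ := Ultrafilter.exists_ultrafilter_of_finite_inter_nonempty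
    ((fun ψ : ParamFormula L x U => {a : x → M | ψ.1.Realize (glue (f ∘ a) ψ.2)}) '' q.formulas)
    (by
      intro T hT
      obtain ⟨s, hs, rfl⟩ := Finset.subset_set_image_iff.1 hT
      obtain ⟨a, ha⟩ := hq.2 s hs s.finite_toSet
      refine ⟨a, ?_⟩
      simp only [Finset.coe_image, Set.sInter_image, Set.mem_iInter]
      exact ha)
  exact ⟨V, DeltaType.eq_of_subset fun ψ hψ => ⟨q.mem_delta ψ hψ, hV ⟨ψ, hψ, rfl⟩⟩⟩

theorem isCoheir_averageType (hneg : ∀ φ ∈ Δ, φ.not ∈ Δ) (f : M ↪ₑ[L] U) {I : Type*}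
    (a : I → x → M) (V : Ultrafilter I) :
    IsCoheir f (averageType hneg a V) (averageType hneg (fun i => f ∘ a i) V) := by
  refine ⟨fun ψ hψ => ⟨hψ.1, hψ.2.mono fun i hi => ?_⟩, fun s hs hfin => ?_⟩
  · rw [← comp_glue, f.map_formula]
    exact hi
  · obtain ⟨i, hi⟩ := ((Filter.eventually_all_finite hfin).2 fun ψ hψ => (hs hψ).2).exists
    exact ⟨a i, hi⟩

theorem mk_coheirs_le (hneg : ∀ φ ∈ Δ, φ.not ∈ Δ) :
    #{q : DeltaType Δ x U // IsCoheir f p q} ≤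
      2 ^ ((2 : Cardinal.{max u v w}) ^ Cardinal.lift.{max u v} (max ℵ₀ #M)) := by
  choose V hV using fun q : {q : DeltaType Δ x U // IsCoheir f p q} =>
    q.2.exists_eq_averageType hneg
  have h1 : #{q : DeltaType Δ x U // IsCoheir f p q} ≤
      #(ULift.{max u v} (Ultrafilter (x → M))) :=
    mk_le_of_injective (f := fun q => ULift.up (V q)) fun q r h => Subtype.ext (by
      rw [hV q, hV r, ULift.up_injective h])
  refine h1.trans ?_
  rw [mk_uLift]
  refine (lift_le.2 (mk_ultrafilter_le _)).trans ?_
  rw [lift_power, lift_two, lift_power, lift_two]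
  exact power_le_power_left two_ne_zero
    (power_le_power_left two_ne_zero (lift_le.2 (mk_tuples_le M x)))

end Coheirs

/-! ### Independent families in models -/

section Patterns

open scoped Classical in
/-- The formulas saying that `φ(aᵢ, bⱼ)` holds if and only if `R i j`, for variables `aᵢ, bⱼ`. -/
noncomputable def patternFormula (φ : L.Formula ℕ) (x : Finset ℕ) {I J : Type*} (R : I → J → Prop)
    (z : I × J) : L.Formula ((I × x) ⊕ (J × Outside x)) :=
  if R z.1 z.2 then φ.relabel (glue (fun k => Sum.inl (z.1, k)) fun k => Sum.inr (z.2, k))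
  else (φ.relabel (glue (fun k => Sum.inl (z.1, k)) fun k => Sum.inr (z.2, k))).not

theorem realize_patternFormula {φ : L.Formula ℕ} {I J : Type*} {R : I → J → Prop}
    {z : I × J} {N : Type*} [L.Structure N] (v : (I × x) ⊕ (J × Outside x) → N) :
    (patternFormula φ x R z).Realize v ↔
      (φ.Realize (glue (fun k => v (Sum.inl (z.1, k))) fun k => v (Sum.inr (z.2, k))) ↔
        R z.1 z.2) := by
  have h : v ∘ glue (fun k => Sum.inl (z.1, k)) (fun k => Sum.inr (z.2, k)) =
      glue (fun k => v (Sum.inl (z.1, k))) fun k => v (Sum.inr (z.2, k)) := comp_glue _ _ _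
  unfold patternFormula
  split_ifs with hR
  · rw [Formula.realize_relabel, h]
    simp [hR]
  · rw [Formula.realize_not, Formula.realize_relabel, h]
    simp [hR]

theorem isSatisfiable_pattern {T : L.Theory} {φ : L.Formula ℕ} {I J : Type*} [Nonempty I]
    [Nonempty J] {R : I → J → Prop}
    (h : ∀ F : Finset I, ∃ (N : Theory.ModelType.{u, v, w} T) (a : I → x → N)
      (b : J → Outside x → N), ∀ i ∈ F, ∀ j, φ.Realize (glue (a i) (b j)) ↔ R i j) :
    (realizingTheory T (patternFormula φ x R)).IsSatisfiable := by
  classical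
  refine isSatisfiable_realizingTheory.{u, v, w} fun F => ?_
  obtain ⟨N, a, b, hab⟩ := h (F.image Prod.fst)
  exact ⟨N, Sum.elim (fun z => a z.1 z.2) (fun z => b z.1 z.2), fun z hz =>
    (realize_patternFormula _).2 (hab z.1 (Finset.mem_image_of_mem _ hz) z.2)⟩

theorem exists_realize_of_model_pattern {T : L.Theory} {φ : L.Formula ℕ} {I J : Type*}
    {R : I → J → Prop} (N : Type*) [L[[(I × x) ⊕ (J × Outside x)]].Structure N]
    (hN : N ⊨ realizingTheory T (patternFormula φ x R)) :
    ∃ (_ : L.Structure N) (a : I → x → N) (b : J → Outside x → N), N ⊨ T ∧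
      ∀ i j, φ.Realize (glue (a i) (b j)) ↔ R i j := by
  obtain ⟨hs, v, hT, hv⟩ := exists_realize_of_model_realizingTheory N hN
  exact ⟨hs, fun i k => v (Sum.inl (i, k)), fun j k => v (Sum.inr (j, k)), hT,
    fun i j => (realize_patternFormula v).1 (hv (i, j))⟩

/-- Compactness; it also moves the model to the universe that `HasIP` asks for. -/
theorem hasIP_of_shattered {T : L.Theory} {φ : L.Formula ℕ}
    (h : ∀ F : Finset ℕ, ∃ (N : Theory.ModelType.{u, v, w} T) (a : ℕ → x → N)
      (b : Set ℕ → Outside x → N), ∀ i ∈ F, ∀ S, φ.Realize (glue (a i) (b S)) ↔ i ∈ S) :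
    HasIP T φ x := by
  obtain ⟨N⟩ := isSatisfiable_pattern.{u, v, w} h
  obtain ⟨hs, a, b, hT, hab⟩ := exists_realize_of_model_pattern N N.is_model
  exact ⟨Theory.ModelType.of T N, a, b, hab⟩

theorem infinite_of_shattered {φ : L.Formula ℕ} {I N : Type*} [Infinite I] [L.Structure N]
    {a : I → x → N} {b : Finset I → Outside x → N}
    (h : ∀ i j, φ.Realize (glue (a i) (b j)) ↔ i ∈ j) : Infinite N := by
  have ha : Function.Injective a := by
    intro i i' he
    have h1 := (h i {i}).2 (Finset.mem_singleton_self i)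
    rw [he, h] at h1
    exact (Finset.mem_singleton.1 h1).symm
  by_contra hN
  rw [not_infinite_iff_finite] at hN
  exact not_finite_iff_infinite.2 (Infinite.of_injective a ha) inferInstance

/-- A model of prescribed cardinality containing an infinite independent family. -/
theorem HasIP.exists_model {T : L.Theory} {φ : L.Formula ℕ} (h : HasIP T φ x) (I : Type w)
    (hI : Cardinal.lift.{w} (theoryCard L) ≤ Cardinal.lift.{max u v} #I) :
    ∃ (M : Type w) (_ : L.Structure M), M ⊨ T ∧ #M = #I ∧
      ∃ (a : I → x → M) (b : Finset I → Outside x → M),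
        ∀ i j, φ.Realize (glue (a i) (b j)) ↔ i ∈ j := by
  classical
  have hI0 : ℵ₀ ≤ #I := by
    rw [← lift_le.{max u v}, lift_aleph0]
    refine le_trans ?_ hI
    rw [← lift_aleph0.{w}, lift_le]
    exact le_max_left _ _
  have : Infinite I := infinite_iff.2 hI0
  have hsat : (realizingTheory T
      (patternFormula φ x (fun (i : I) (j : Finset I) => i ∈ j))).IsSatisfiable := by
    refine isSatisfiable_pattern.{u, v, max u v} fun F => ?_
    obtain ⟨N, a, b, hab⟩ := h
    -- An injection of the finite set `F` into `ℕ` pulls back the countable family given by IP.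
    obtain ⟨g, hg⟩ := Set.countable_iff_exists_injOn.1 F.finite_toSet.countable
    refine ⟨N, fun i => a (g i), fun j => b (g '' (F ∩ j)), fun i hi j => ?_⟩
    rw [hab, hg.mem_image_iff Set.inter_subset_left hi]
    simp [Finset.mem_coe.1 hi]
  obtain ⟨N⟩ := hsat
  have hN : Infinite N := by
    obtain ⟨hs, a, b, hT, hab⟩ := exists_realize_of_model_pattern N N.is_model
    exact infinite_of_shattered hab
  obtain ⟨M, hM⟩ := Theory.exists_model_card_eq ⟨N, hN⟩ #I hI0 (by
    -- Using only finite subsets of `I` as indices keeps the new constants at most `#I` in number.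
    have hα : #((I × x) ⊕ (Finset I × Outside x)) ≤ #I := by
      rw [mk_sum, mk_prod, mk_prod, mk_finset_of_infinite]
      simp only [lift_id, lift_uzero]
      exact add_le_of_le hI0 (mul_le_of_le hI0 le_rfl ((lift_le_aleph0.2 mk_le_aleph0).trans hI0))
        (mul_le_of_le hI0 le_rfl ((lift_le_aleph0.2 mk_le_aleph0).trans hI0))
    have hL : Cardinal.lift.{w} L.card ≤ Cardinal.lift.{max u v} #I :=
      (lift_le.2 (le_max_right _ _)).trans hI
    rw [card_withConstants]
    simp only [lift_add, lift_lift]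
    refine add_le_of_le ?_ ?_ ?_
    · simp
    · exact hL.trans_eq (congrFun lift_umax.{w, max u v} #I).symm
    · exact lift_le.2 hα)
  obtain ⟨hs, a, b, hT, hab⟩ := exists_realize_of_model_pattern M M.is_model
  exact ⟨M, hs, hT, hM, a, b, hab⟩

/-- On a finite `F ⊆ I` the parameter `b (F ∩ S)` already works; saturation does the rest. -/
theorem IsSaturated.exists_realize_subset {κ : Cardinal.{w}} {M U : Type w} [L.Structure M]
    [L.Structure U] [Nonempty M] (hU : IsSaturated L κ U) (hM : #M < κ) (f : M ↪ₑ[L] U)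
    {φ : L.Formula ℕ} {I : Type*} {a : I → x → M} {b : Finset I → Outside x → M}
    (h : ∀ i j, φ.Realize (glue (a i) (b j)) ↔ i ∈ j) (S : Set I) :
    ∃ c : Outside x → U, ∀ i, φ.Realize (glue (f ∘ a i) c) ↔ i ∈ S := by
  classical
  let n := φ.freeVarFinset.sup id
  have hn : ∀ k ∈ φ.freeVarFinset, k < n + 1 := fun k hk =>
    Nat.lt_succ_of_le (Finset.le_sup (f := id) hk)
  -- Saturation allows only finitely many variables. Reducing modulo `n + 1` fixes those occurring
  -- in `φ`; the others are irrelevant.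
  let r : Outside x → Fin (n + 1) := fun k => Fin.ofNat (n + 1) k.1
  let ψ : I → L.Formula (M ⊕ Fin (n + 1)) := fun i =>
    φ.relabel (glue (fun k => Sum.inl (a i k)) fun k => Sum.inr (r k))
  have hψ : ∀ i d, (ψ i).Realize (Sum.elim f d) ↔ φ.Realize (glue (f ∘ a i) (d ∘ r)) := by
    intro i d
    rw [Formula.realize_relabel, comp_glue]
    rfl
  obtain ⟨d, hd⟩ := hU.exists_realize f hM (fun i => if i ∈ S then ψ i else (ψ i).not) (by
    intro F
    let c := b (F.filter (· ∈ S))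
    let c' : ℕ → M := glue (fun _ => Classical.arbitrary M) c
    refine ⟨fun t => f (c' t), fun i hi => ?_⟩
    have key : (ψ i).Realize (Sum.elim f fun t : Fin (n + 1) => f (c' t)) ↔ i ∈ S := by
      rw [hψ, realize_congr_freeVars φ (v' := f ∘ glue (a i) c), f.map_formula, h]
      · simp [hi]
      · intro k hk
        have hk' := hn k hk
        by_cases hx : k ∈ x
        · simp [glue, hx]
        · simp [glue, hx, r, c', Nat.mod_eq_of_lt hk']
    split_ifs with hS
    · exact key.2 hS
    · exact Formula.realize_not.2 (mt key.1 hS))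
  refine ⟨d ∘ r, fun i => ?_⟩
  rw [← hψ]
  have := hd i
  split_ifs at this with hS
  · exact iff_of_true this hS
  · exact iff_of_false (Formula.realize_not.1 this) hS

end Patterns

end Types

/-! ### The two bounds on coheirs -/

section Counting

variable {L : FirstOrder.Language.{u, v}} {Δ : Set (L.Formula ℕ)} {x : Finset ℕ}

theorem mk_coheirs_le_of_not_hasIP {T : L.Theory} (hneg : ∀ φ ∈ Δ, φ.not ∈ Δ)
    (hT : ∀ φ ∈ Δ, ¬ HasIP T φ x) {M U : Type w} [L.Structure M] [L.Structure U] [Nonempty U]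
    [U ⊨ T] (f : M ↪ₑ[L] U) (p : DeltaType Δ x M) :
    #{q : DeltaType Δ x U // IsCoheir f p q} ≤
      2 ^ (Cardinal.lift.{max u v} #M + Cardinal.lift.{w} (theoryCard L)) := by
  choose V hV using fun q : {q : DeltaType Δ x U // IsCoheir f p q} =>
    q.2.exists_eq_averageType hneg
  let A : L.Formula ℕ → (Outside x → U) → (x → M) → Prop := fun φ b a =>
    φ.Realize (glue (f ∘ a) b)
  -- A coheir is recovered from its patterns for all `φ`: otherwise some formula of `Δ` would
  -- shatter all finite sets.
  have hinj : Function.Injective fun q : {q : DeltaType Δ x U // IsCoheir f p q} =>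
      {z : L.Formula ℕ × (List Bool × List ((x → M) × Bool)) |
        z.2 ∈ iteratedPatterns (A z.1) (V q)} := by
    intro q r h
    refine Subtype.ext (DeltaType.eq_of_subset fun ⟨φ, b⟩ hψ => ?_)
    rw [hV q] at hψ
    rw [hV r]
    refine ⟨hψ.1, ?_⟩
    by_contra hn
    have he : iteratedPatterns (A φ) (V q) = iteratedPatterns (A φ) (V r) :=
      Set.ext fun z => Set.ext_iff.1 h (φ, z)
    refine hT φ hψ.1 (hasIP_of_shattered.{u, v, w} fun F => ?_)
    obtain ⟨g, c, hgc⟩ := exists_shattered_of_iteratedPatterns_eq (b := b) he hψ.2 hn F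
    exact ⟨Theory.ModelType.of T U, fun i => f ∘ g i, c, hgc⟩
  refine (mk_le_of_injective hinj).trans ?_
  rw [mk_set]
  refine power_le_power_left two_ne_zero ?_
  have h0 : ℵ₀ ≤ Cardinal.lift.{w} (theoryCard L) := by
    rw [← lift_aleph0.{w}, lift_le]
    exact le_max_left _ _
  have h1 : ℵ₀ ≤ Cardinal.lift.{max u v} #M + Cardinal.lift.{w} (theoryCard L) :=
    h0.trans (self_le_add_left _ _)
  have h2 : #((x → M) × Bool) ≤ max ℵ₀ #M := by
    rw [mk_prod, lift_uzero]
    exact mul_le_of_le (le_max_left _ _) (mk_tuples_le M x)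
      ((lift_le_aleph0.2 mk_le_aleph0).trans (le_max_left _ _))
  have h3 : #(List Bool × List ((x → M) × Bool)) ≤ max ℵ₀ #M := by
    rw [mk_prod, lift_uzero]
    exact mul_le_of_le (le_max_left _ _)
      ((lift_le_aleph0.2 mk_le_aleph0).trans (le_max_left _ _))
      ((mk_list_le_max _).trans (max_le (le_max_left _ _) h2))
  rw [mk_prod]
  refine mul_le_of_le h1 ((lift_le.2 mk_formula_le).trans (self_le_add_left _ _)) ?_
  refine (lift_le.2 h3).trans ?_
  rw [lift_max, lift_aleph0]
  exact max_le h1 (self_le_add_right _ _)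

/-- Among the average types of a family indexed by an infinite set, one is attained as often as
possible. -/
theorem exists_averageType_fiber (hneg : ∀ φ ∈ Δ, φ.not ∈ Δ) {I M : Type w} [L.Structure M]
    [Infinite I] (hM : #M = #I)
    (hI : Cardinal.lift.{w} (theoryCard L) ≤ Cardinal.lift.{max u v} #I) (a : I → x → M) :
    ∃ p : DeltaType Δ x M, 2 ^ ((2 : Cardinal.{max u v w}) ^ Cardinal.lift.{max u v} #I) ≤
      Cardinal.lift.{max u v} #{V : Ultrafilter I // averageType hneg a V = p} := by
  have hI0 : ℵ₀ ≤ Cardinal.lift.{max u v} #I := by simp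
  have hp : ℵ₀ ≤ (2 : Cardinal.{max u v w}) ^ Cardinal.lift.{max u v} #I :=
    hI0.trans (cantor _).le
  have : Infinite M := by
    rw [infinite_iff, hM]
    exact aleph0_le_mk I
  -- The number of types, at most `2 ^ #I`, is below the cofinality of `2 ^ 2 ^ #I`, so some fibre
  -- has full size.
  obtain ⟨p, hp⟩ := infinite_pigeonhole_card
    (fun V : ULift.{max u v} (Ultrafilter I) => (averageType hneg a V.down : DeltaType Δ x M))
    (2 ^ ((2 : Cardinal.{max u v w}) ^ Cardinal.lift.{max u v} #I))
    (by rw [mk_uLift, mk_ultrafilter, lift_power, lift_power, lift_two])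
    (hp.trans (cantor _).le)
    (((mk_deltaType_le M (by rwa [hM])).trans_eq (by rw [hM])).trans_lt
      (lt_cof_ord_power hp one_lt_two))
  refine ⟨p, hp.trans ?_⟩
  rw [← mk_uLift]
  exact mk_le_of_injective (f := fun V => ULift.up ⟨V.1.down, V.2⟩) fun V W h =>
    Subtype.ext (ULift.down_injective (congrArg Subtype.val (ULift.up_injective h)))

theorem mk_coheirs_eq (hneg : ∀ φ ∈ Δ, φ.not ∈ Δ) {φ : L.Formula ℕ} (hφ : φ ∈ Δ)
    {I M U : Type w} [L.Structure M] [L.Structure U] [Infinite I] (hM : #M = #I)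
    {a : I → x → M} {b : Finset I → Outside x → M}
    (hab : ∀ i j, φ.Realize (glue (a i) (b j)) ↔ i ∈ j) {p : DeltaType Δ x M}
    (hp : 2 ^ ((2 : Cardinal.{max u v w}) ^ Cardinal.lift.{max u v} #I) ≤
      Cardinal.lift.{max u v} #{V : Ultrafilter I // averageType hneg a V = p})
    {κ : Cardinal.{w}} (hU : IsSaturated L κ U) (hκ : #I < κ) (f : M ↪ₑ[L] U) :
    #{q : DeltaType Δ x U // IsCoheir f p q} =
      2 ^ ((2 : Cardinal.{max u v w}) ^ Cardinal.lift.{max u v} #I) := by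
  refine le_antisymm ?_ (hp.trans ?_)
  · refine (mk_coheirs_le hneg).trans_eq ?_
    rw [hM, max_eq_right (aleph0_le_mk I)]
  · have : Nonempty M := by
      rw [← mk_ne_zero_iff, hM]
      exact mk_ne_zero I
    rw [← mk_uLift]
    refine mk_le_of_injective (f := fun V : ULift {V : Ultrafilter I // averageType hneg a V = p} =>
      (⟨averageType hneg (fun i => f ∘ a i) V.down.1, by
        have h := isCoheir_averageType hneg f a V.down.1
        rwa [V.down.2] at h⟩ : {q : DeltaType Δ x U // IsCoheir f p q})) fun V W h => ?_
    refine ULift.down_injective (Subtype.ext (Ultrafilter.ext fun S => ?_))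
    -- The instance `φ(x, c)` defines `S` on the family, so it lies in the average over `U` exactly
    -- when `S` is in the ultrafilter.
    obtain ⟨c, hc⟩ := hU.exists_realize_subset (hM ▸ hκ) f hab S
    have hmem : ∀ Z : Ultrafilter I,
        (φ, c) ∈ (averageType hneg (fun i => f ∘ a i) Z).formulas ↔ S ∈ Z := by
      intro Z
      refine (and_iff_right hφ).trans ?_
      simp only [hc]
      exact Iff.rfl
    rw [← hmem, ← hmem]
    exact iff_of_eq (congrArg (fun q => (φ, c) ∈ q.1.formulas) h)

end Counting

end Fragment

theorem mainTheorem10 {L : FirstOrder.Language.{u, v}} (T : L.Theory)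
    (Δ : Set (L.Formula ℕ)) (hΔ : Fragment.IsFragment Δ) (hneg : ∀ φ ∈ Δ, φ.not ∈ Δ)
    (x : Finset ℕ) :
    (Fragment.IsDeltaNIP T Δ →
      ∀ (κ : Cardinal.{w}) (U : Type w) [L.Structure U] [U ⊨ T], Fragment.IsMonster L κ U →
      ∀ (M : Type w) [L.Structure M] [Nonempty M] (f : M ↪ₑ[L] U), #M < κ →
      ∀ p : Fragment.DeltaType Δ x M,
        #{q : Fragment.DeltaType Δ x U // Fragment.IsCoheir f p q} ≤
          2 ^ (Cardinal.lift.{max u v} #M + Cardinal.lift.{w} (Fragment.theoryCard L)))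
    ∧
    ((∃ φ ∈ Δ, Fragment.HasIP T φ x) →
      ∀ lam : Cardinal.{w},
      Cardinal.lift.{w} (Fragment.theoryCard L) ≤ Cardinal.lift.{max u v} lam →
      ∃ (M : Type w) (_ : L.Structure M), M ⊨ T ∧ #M = lam ∧
        (∃ p : Fragment.DeltaType Δ x M,
          ∀ (κ : Cardinal.{w}) (U : Type w) [L.Structure U], Fragment.IsMonster L κ U → lam < κ →
          ∀ f : M ↪ₑ[L] U,
            #{q : Fragment.DeltaType Δ x U // Fragment.IsCoheir f p q} =
              2 ^ ((2 : Cardinal.{max u v w}) ^ Cardinal.lift.{max u v} lam)) ∧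
        (T.IsComplete →
          ∀ (κ : Cardinal.{w}) (U : Type w) [L.Structure U] [Nonempty U] [U ⊨ T],
          Fragment.IsMonster L κ U → lam < κ → Nonempty (M ↪ₑ[L] U))) := by
  refine ⟨fun hT κ U _ _ _ M _ _ f _ p => ?_, fun ⟨φ, hφ, hIP⟩ lam hlam => ?_⟩
  · have : Nonempty U := Nonempty.map f inferInstance
    exact Fragment.mk_coheirs_le_of_not_hasIP hneg (fun φ hφ => hT φ hφ x) f p
  · induction lam using Cardinal.inductionOn with
    | mk I =>
    obtain ⟨M, hs, hMT, hM, a, b, hab⟩ := hIP.exists_model I hlam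
    have hI : Infinite I := by
      rw [infinite_iff, ← lift_le.{max u v}, lift_aleph0]
      refine le_trans ?_ hlam
      rw [← lift_aleph0.{w}, lift_le]
      exact le_max_left _ _
    obtain ⟨p, hp⟩ := Fragment.exists_averageType_fiber hneg hM hlam a
    have : Nonempty M := by
      rw [← mk_ne_zero_iff, hM]
      exact mk_ne_zero I
    exact ⟨M, hs, hMT, hM,
      ⟨p, fun κ U _ hU hκ f => Fragment.mk_coheirs_eq hneg hφ hM hab hp hU.saturated hκ f⟩,
      fun hT κ U _ _ _ hU hκ => hU.saturated.nonempty_elementaryEmbedding (hM ▸ hκ) fun ψ =>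
        (hT.realize_sentence_iff ψ M).trans (hT.realize_sentence_iff ψ U).symm⟩
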